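/- Let $\mathcal A=\{1,2\}$ be a set of two agents. Formulas of $\mathcal L_{\mathbf D}$ are built from atoms, $\top$, $\bot$, $\neg$, $\wedge$, $\vee$ and the distributed knowledge operators $\mathbf D_{\mathcal B}$ for nonempty $\mathcal B\subseteq\mathcal A$ (with $\mathbf K_i=\mathbf D_{\{i\}}$); in a Kripke model, $\mathbf D_{\mathcal B}$ is the box of $R_{\mathcal B}=\bigcap_{i\in\mathcal B}R_i$. Write $\hat{\mathbf D}_{\mathcal B}=\neg\mathbf D_{\mathcal B}\neg$. Let $\mathsf L$ be one of $\mathsf{K45}_2\mathbf D$, $\mathsf{KD45}_2\mathbf D$, $\mathsf{S5}_2\mathbf D$; its models are the Kripke models in which every $R_i$ is transitive and Euclidean, respectively serial, transitive and Euclidean, respectively reflexive, transitive and Euclidean. Satisfiability and entailment $\vDash_{\mathsf L}$ are over pointed $\mathsf L$-models. $\mathcal P(\varphi)$ is the set of atoms of $\varphi$, and $dep(\varphi)$ its modal depth. For a finite set $P$ of atoms, $D^P_0$ is the set of minterms of $P$, and $D^P_{k+1}$ is the set of formulas $\delta_0\wedge\bigwedge_{\emptyset\ne\mathcal B\subseteq\mathcal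 A}\nabla_{\mathcal B}\Phi_{\mathcal B}$ with $\delta_0\in D^P_0$ and $\Phi_{\mathcal B}\subseteq D^P_k$, where $\nabla_{\mathcal B}\Phi=\mathbf D_{\mathcal B}(\bigvee\Phi)\wedge\bigwedge_{\varphi\in\Phi}\hat{\mathbf D}_{\mathcal B}\varphi$ (finite conjunctions end in $\top$ and finite disjunctions end in $\bot$, so that a minterm is never a bare atom). For an atom $p$, $\varphi^p$ is obtained from $\varphi$ by replacing all occurrences of $\neg p$ by $\top$ and then all occurrences of $p$ by $\top$. A collective $p$-bisimulation between $(M,s)$ and $(M',s')$ is a relation $\rho$ between their worlds with $s\mathrel\rho s'$ such that, whenever $u\mathrel\rho u'$: the worlds $u,u'$ satisfy the same atoms other than $p$, and for every nonempty $\mathcal C\subseteq\mathcal A$ every $v\in R_{\mathcal C}(u)$ has some $v'\in R'_{\mathcal C}(u')$ with $v\mathrel\rho v'$, and vice versa. A formula $\psi$ is a result of forgetting $p$ in $\varphi$, written $dforget_{\mathsf L}(\varphi,p)\equiv_{\mathsf L}\psi$, if $\mathcal P(\psi)\subseteq\mathcal P(\varphi)\setminus\{p\}$; every $\mathsf L$-model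 that is collectively $p$-bisimilar to an $\mathsf L$-model of $\varphi$ satisfies $\psi$; and every pointed $\mathsf L$-model of $\psi$ is collectively $p$-bisimilar to some pointed $\mathsf L$-model of $\varphi$. A formula $\psi$ is a uniform interpolant of $\varphi$ over $P\setminus\{p\}$ if it is $\mathsf L$-satisfiable, $\mathcal P(\psi)\subseteq P\setminus\{p\}$, and $\varphi\vDash_{\mathsf L}\chi\iff\psi\vDash_{\mathsf L}\chi$ for every formula $\chi$ of $\mathcal L_{\mathbf D}$ in which $p$ does not occur. **Proposition.** Let $P$ be a finite set of atoms and $p$ an atom. 1. For every $k\ge 0$ and every $\mathsf L$-satisfiable $\delta\in D^P_k$, $dforget_{\mathsf L}(\delta,p)\equiv_{\mathsf L}\delta^p$. Moreover, $\delta^p$ is a uniform interpolant of $\delta$ over $P\setminus\{p\}$, and $dep(\delta^p)=dep(\delta)$. 2. Every $\mathsf L$-satisfiable formula $\varphi$ of $\mathcal L_{\mathbf D}$ with $\mathcal P(\varphi)\subseteq P$ has a result $\psi$ of forgetting $p$ that is a uniform interpolant of $\varphi$ over $P\setminus\{p\}$ and satisfies $dep(\psi)=dep(\varphi)$. -/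

import Mathlib

namespace DistKnow

universe u w

/-- The nonempty subsets of the set of agents. -/
abbrev Coalition (Agent : Type w) : Type w := {B : Finset Agent // B.Nonempty}

/-- Formulas of epistemic logic with distributed knowledge. -/
inductive Formula (Agent : Type w) (Atom : Type u) : Type (max u w)
  | atom : Atom → Formula Agent Atom
  | top : Formula Agent Atom
  | bot : Formula Agent Atom
  | neg : Formula Agent Atom → Formula Agent Atom
  | and : Formula Agent Atom → Formula Agent Atom → Formula Agent Atom
  | or : Formula Agent Atom → Formula Agent Atom → Formula Agent Atom
  | dist : Coalition Agent → Formula Agent Atom → Formula Agent Atom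

namespace Formula

variable {Agent : Type w} {Atom : Type u}

/-- Individual knowledge `K_i`, identified with distributed knowledge of the group `{i}`. -/
def know (i : Agent) (φ : Formula Agent Atom) : Formula Agent Atom :=
  dist ⟨{i}, Finset.singleton_nonempty i⟩ φ

/-- The dual `¬ D_B ¬ φ` of distributed knowledge. -/
def diam (B : Coalition Agent) (φ : Formula Agent Atom) : Formula Agent Atom :=
  neg (dist B (neg φ))

/-- The atoms that occur in a formula. -/
def atoms [DecidableEq Atom] : Formula Agent Atom → Finset Atom
  | atom q => {q}
  | top => ∅
  | bot => ∅
  | neg φ => φ.atoms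
  | and φ ψ => φ.atoms ∪ ψ.atoms
  | or φ ψ => φ.atoms ∪ ψ.atoms
  | dist _ φ => φ.atoms

/-- Modal depth: the depth of nesting of modal operators. -/
def depth : Formula Agent Atom → ℕ
  | atom _ => 0
  | top => 0
  | bot => 0
  | neg φ => φ.depth
  | and φ ψ => max φ.depth ψ.depth
  | or φ ψ => max φ.depth ψ.depth
  | dist _ φ => φ.depth + 1

/-- Conjunction of a list of formulas; the empty conjunction is `⊤`. -/
def conj (l : List (Formula Agent Atom)) : Formula Agent Atom := l.foldr and top

/-- Disjunction of a list of formulas; the empty disjunction is `⊥`. -/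
def disj (l : List (Formula Agent Atom)) : Formula Agent Atom := l.foldr or bot

/-- The cover modality `∇_B Φ`, that is, `D_B (⋁ Φ) ∧ ⋀ {¬ D_B ¬ φ | φ ∈ Φ}`. -/
noncomputable def nabla (B : Coalition Agent) (Φ : Finset (Formula Agent Atom)) :
    Formula Agent Atom :=
  and (dist B (disj Φ.toList)) (conj (Φ.toList.map (diam B)))

/-- The minterm of `P` in which exactly the atoms of `S` occur positively (for `S ⊆ P`). -/
noncomputable def minterm [DecidableEq Atom] (P S : Finset Atom) : Formula Agent Atom :=
  and (conj (S.toList.map atom)) (conj ((P \ S).toList.map fun q => neg (atom q)))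

/-- The set of d-canonical formulas of `P` at level `k`. -/
def dCanonical [Fintype Agent] [DecidableEq Atom] (P : Finset Atom) :
    ℕ → Set (Formula Agent Atom)
  | 0 => {δ | ∃ S : Finset Atom, S ⊆ P ∧ δ = minterm P S}
  | k + 1 => {δ | ∃ S : Finset Atom, S ⊆ P ∧
      ∃ Φ : Coalition Agent → Finset (Formula Agent Atom),
        (∀ B, ∀ η ∈ Φ B, η ∈ dCanonical P k) ∧
        δ = and (minterm P S)
          (conj ((Finset.univ : Finset (Coalition Agent)).toList.map fun B => nabla B (Φ B)))}

/-- Replace every occurrence of the subformula `¬ p` by `⊤`. -/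
def substNegAtom [DecidableEq Atom] (p : Atom) : Formula Agent Atom → Formula Agent Atom
  | neg (atom q) => if q = p then top else neg (atom q)
  | atom q => atom q
  | top => top
  | bot => bot
  | neg φ => neg (φ.substNegAtom p)
  | and φ ψ => and (φ.substNegAtom p) (ψ.substNegAtom p)
  | or φ ψ => or (φ.substNegAtom p) (ψ.substNegAtom p)
  | dist B φ => dist B (φ.substNegAtom p)

/-- Replace every occurrence of `p` by `⊤`. -/
def substAtom [DecidableEq Atom] (p : Atom) : Formula Agent Atom → Formula Agent Atom
  | atom q => if q = p then top else atom q
  | top => top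
  | bot => bot
  | neg φ => neg (φ.substAtom p)
  | and φ ψ => and (φ.substAtom p) (ψ.substAtom p)
  | or φ ψ => or (φ.substAtom p) (ψ.substAtom p)
  | dist B φ => dist B (φ.substAtom p)

/-- Literal elimination `φ^p`: first `¬ p` is replaced by `⊤`, and then `p` is replaced by `⊤`. -/
def litElim [DecidableEq Atom] (p : Atom) (φ : Formula Agent Atom) : Formula Agent Atom :=
  (φ.substNegAtom p).substAtom p

end Formula

/-- Kripke models. -/
structure Model (Agent : Type w) (Atom : Type u) where
  World : Type u
  nonempty : Nonempty World
  rel : Agent → World → World → Prop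
  val : World → Set Atom

namespace Model

variable {Agent : Type w} {Atom : Type u}

/-- The relation of a group is the intersection of the relations of its members. -/
def groupRel (M : Model Agent Atom) (B : Coalition Agent) (s t : M.World) : Prop :=
  ∀ i ∈ B.1, M.rel i s t

/-- Truth of a formula at a world of a model. -/
def Sat (M : Model Agent Atom) : M.World → Formula Agent Atom → Prop
  | s, .atom q => q ∈ M.val s
  | _, .top => True
  | _, .bot => False
  | s, .neg φ => ¬ M.Sat s φ
  | s, .and φ ψ => M.Sat s φ ∧ M.Sat s ψ
  | s, .or φ ψ => M.Sat s φ ∨ M.Sat s ψ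
  | s, .dist B φ => ∀ t, M.groupRel B s t → M.Sat t φ

def IsSerial (M : Model Agent Atom) : Prop := ∀ i s, ∃ t, M.rel i s t

def IsReflexive (M : Model Agent Atom) : Prop := ∀ i s, M.rel i s s

def IsTransitive (M : Model Agent Atom) : Prop :=
  ∀ i s t r, M.rel i s t → M.rel i t r → M.rel i s r

def IsEuclidean (M : Model Agent Atom) : Prop :=
  ∀ i s t r, M.rel i s t → M.rel i s r → M.rel i t r

end Model

/-- `ρ` is a collective `p`-bisimulation between the pointed models `(M, s)` and `(M', s')`. -/
structure IsColBisimulation {Agent : Type w} {Atom : Type u} (p : Atom)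
    (M : Model Agent Atom) (s : M.World) (M' : Model Agent Atom) (s' : M'.World)
    (ρ : M.World → M'.World → Prop) : Prop where
  base : ρ s s'
  atoms : ∀ v v', ρ v v' → ∀ q, q ≠ p → (q ∈ M.val v ↔ q ∈ M'.val v')
  forth : ∀ v v', ρ v v' → ∀ (C : Coalition Agent) (t : M.World), M.groupRel C v t →
    ∃ t', M'.groupRel C v' t' ∧ ρ t t'
  back : ∀ v v', ρ v v' → ∀ (C : Coalition Agent) (t' : M'.World), M'.groupRel C v' t' →
    ∃ t, M.groupRel C v t ∧ ρ t t'

/-- Two pointed models are collectively `p`-bisimilar. -/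
def ColBisimilar {Agent : Type w} {Atom : Type u} (p : Atom)
    (M : Model Agent Atom) (s : M.World) (M' : Model Agent Atom) (s' : M'.World) : Prop :=
  ∃ ρ : M.World → M'.World → Prop, IsColBisimulation p M s M' s' ρ

/-- The three modal systems with transitive and Euclidean accessibility relations. -/
inductive ModalSystem : Type
  | K45
  | KD45
  | S5

namespace ModalSystem

variable {Agent : Type w} {Atom : Type u}

/-- The models of each system. -/
def IsModel : ModalSystem → Model Agent Atom → Prop
  | K45, M => M.IsTransitive ∧ M.IsEuclidean
  | KD45, M => M.IsSerial ∧ M.IsTransitive ∧ M.IsEuclidean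
  | S5, M => M.IsSerial ∧ M.IsReflexive ∧ M.IsTransitive ∧ M.IsEuclidean

/-- `φ` is satisfiable in the system `L`. -/
def Satisfiable (L : ModalSystem) (φ : Formula Agent Atom) : Prop :=
  ∃ (M : Model Agent Atom) (s : M.World), L.IsModel M ∧ M.Sat s φ

/-- `φ` entails `ψ` in the system `L`. -/
def Entails (L : ModalSystem) (φ ψ : Formula Agent Atom) : Prop :=
  ∀ (M : Model Agent Atom) (s : M.World), L.IsModel M → M.Sat s φ → M.Sat s ψ

/-- `ψ` is a result of forgetting `p` in `φ` in the system `L`. -/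
structure IsForgetting [DecidableEq Atom] (L : ModalSystem) (φ : Formula Agent Atom) (p : Atom)
    (ψ : Formula Agent Atom) : Prop where
  atoms_subset : ψ.atoms ⊆ φ.atoms \ {p}
  forth : ∀ (M : Model Agent Atom) (s : M.World) (M' : Model Agent Atom) (s' : M'.World),
    L.IsModel M → L.IsModel M' → M.Sat s φ → ColBisimilar p M s M' s' → M'.Sat s' ψ
  back : ∀ (M' : Model Agent Atom) (s' : M'.World), L.IsModel M' → M'.Sat s' ψ →
    ∃ (M : Model Agent Atom) (s : M.World),
      L.IsModel M ∧ M.Sat s φ ∧ ColBisimilar p M s M' s'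

/-- `ψ` is a uniform interpolant of `φ` in the system `L` over `P \ {p}`. -/
structure IsUniformInterpolant [DecidableEq Atom] (L : ModalSystem) (P : Finset Atom)
    (φ : Formula Agent Atom) (p : Atom) (ψ : Formula Agent Atom) : Prop where
  satisfiable : L.Satisfiable ψ
  atoms_subset : ψ.atoms ⊆ P \ {p}
  entails_iff : ∀ χ : Formula Agent Atom, p ∉ χ.atoms → (L.Entails φ χ ↔ L.Entails ψ χ)

end ModalSystem

end DistKnow

/-! Replacing the `p`-literals of a canonical formula by `⊤` only weakens it, and `δ^p` is free of
`p`, hence invariant under collective `p`-bisimulation: this is one half of forgetting. For the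
other half, let `(M, x)` satisfy `δ^p` and `(N, y)` satisfy `δ`. Comparing covers level by level,
the two are bisimilar up to depth `k` over `P \ {p}` (`BisimUpTo.of_dCanonical`). It remains to
build an amalgam (`exists_amalgam`): a model `p`-bisimilar to `M` that agrees with `N` to depth `k`
on `p` as well.

Its worlds are pairs of worlds with one label per agent, the depth to which that agent's successors
are synchronized. To keep the relations transitive and Euclidean, the label of `i` is constant along
the relation of `i`; a move of `i` from a positive label puts the other agent's label one lower
instead. This is consistent because `i` has the same successors before and after its own move. A
joint move can keep both labels, since neither agent's successors change
(`BisimUpTo.of_forall_rel`). An agent with label 0 follows `M` alone. With two agents there are no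
other coalitions.

For arbitrary `φ`, take the disjunction of `δ^p` over the canonical `δ` at level `dep(φ)` consistent
with `φ`. Uniform interpolation follows from invariance of `p`-free formulas. -/

namespace DistKnow

universe u w

/-! ### Syntax of literal elimination and of canonical formulas. -/

namespace Formula

variable {Agent : Type w} {Atom : Type u}

section LitElim

variable [DecidableEq Atom]

lemma litElim_conj (p : Atom) (l : List (Formula Agent Atom)) :
    (conj l).litElim p = conj (l.map (litElim p)) := by
  induction l with
  | nil => rfl
  | cons a l ih => exact congrArg (Formula.and (a.litElim p)) ih

lemma litElim_disj (p : Atom) (l : List (Formula Agent Atom)) :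
    (disj l).litElim p = disj (l.map (litElim p)) := by
  induction l with
  | nil => rfl
  | cons a l ih => exact congrArg (Formula.or (a.litElim p)) ih

lemma litElim_and (p : Atom) (φ ψ : Formula Agent Atom) :
    (and φ ψ).litElim p = and (φ.litElim p) (ψ.litElim p) := rfl

lemma litElim_atom (p q : Atom) :
    (atom q : Formula Agent Atom).litElim p = if q = p then top else atom q := rfl

lemma litElim_neg_atom (p q : Atom) :
    (neg (atom q) : Formula Agent Atom).litElim p = if q = p then top else neg (atom q) := by
  by_cases h : q = p <;> simp [litElim, substNegAtom, substAtom, h]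

lemma substNegAtom_atoms_subset (p : Atom) (φ : Formula Agent Atom) :
    (φ.substNegAtom p).atoms ⊆ φ.atoms := by
  induction φ with
  | atom q => exact subset_rfl
  | top => exact subset_rfl
  | bot => exact subset_rfl
  | neg φ ih =>
    cases φ with
    | atom q => by_cases h : q = p <;> simp [substNegAtom, atoms, h]
    | _ => exact ih
  | and φ ψ ih₁ ih₂ => exact Finset.union_subset_union ih₁ ih₂
  | or φ ψ ih₁ ih₂ => exact Finset.union_subset_union ih₁ ih₂
  | dist B φ ih => exact ih

lemma substAtom_atoms_subset (p : Atom) (φ : Formula Agent Atom) :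
    (φ.substAtom p).atoms ⊆ φ.atoms \ {p} := by
  induction φ with
  | atom q =>
    by_cases h : q = p
    · simp [substAtom, atoms, h]
    · simp [substAtom, atoms, h]
  | top => simp [substAtom, atoms]
  | bot => simp [substAtom, atoms]
  | neg φ ih => exact ih
  | and φ ψ ih₁ ih₂ =>
    simpa [atoms, substAtom, Finset.union_sdiff_distrib] using Finset.union_subset_union ih₁ ih₂
  | or φ ψ ih₁ ih₂ =>
    simpa [atoms, substAtom, Finset.union_sdiff_distrib] using Finset.union_subset_union ih₁ ih₂
  | dist B φ ih => exact ih

lemma litElim_atoms_subset (p : Atom) (φ : Formula Agent Atom) :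
    (φ.litElim p).atoms ⊆ φ.atoms \ {p} :=
  (substAtom_atoms_subset p _).trans
    (Finset.sdiff_subset_sdiff (substNegAtom_atoms_subset p φ) subset_rfl)

lemma substNegAtom_depth (p : Atom) (φ : Formula Agent Atom) :
    (φ.substNegAtom p).depth = φ.depth := by
  induction φ with
  | atom q => rfl
  | top => rfl
  | bot => rfl
  | neg φ ih =>
    cases φ with
    | atom q => by_cases h : q = p <;> simp [substNegAtom, depth, h]
    | _ => exact ih
  | and φ ψ ih₁ ih₂ => simp [substNegAtom, depth, ih₁, ih₂]
  | or φ ψ ih₁ ih₂ => simp [substNegAtom, depth, ih₁, ih₂]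
  | dist B φ ih => simp [substNegAtom, depth, ih]

lemma substAtom_depth (p : Atom) (φ : Formula Agent Atom) :
    (φ.substAtom p).depth = φ.depth := by
  induction φ with
  | atom q => by_cases h : q = p <;> simp [substAtom, depth, h]
  | top => rfl
  | bot => rfl
  | neg φ ih => exact ih
  | and φ ψ ih₁ ih₂ => simp [substAtom, depth, ih₁, ih₂]
  | or φ ψ ih₁ ih₂ => simp [substAtom, depth, ih₁, ih₂]
  | dist B φ ih => simp [substAtom, depth, ih]

lemma litElim_depth (p : Atom) (φ : Formula Agent Atom) : (φ.litElim p).depth = φ.depth :=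
  (substAtom_depth p _).trans (substNegAtom_depth p φ)

end LitElim

lemma conj_depth_le {n : ℕ} {l : List (Formula Agent Atom)} (h : ∀ φ ∈ l, φ.depth ≤ n) :
    (conj l).depth ≤ n := by
  induction l with
  | nil => exact Nat.zero_le n
  | cons a l ih =>
    exact max_le (h a (by simp)) (ih fun φ hφ => h φ (by simp [hφ]))

lemma disj_depth_le {n : ℕ} {l : List (Formula Agent Atom)} (h : ∀ φ ∈ l, φ.depth ≤ n) :
    (disj l).depth ≤ n := by
  induction l with
  | nil => exact Nat.zero_le n
  | cons a l ih =>
    exact max_le (h a (by simp)) (ih fun φ hφ => h φ (by simp [hφ]))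

lemma conj_atoms_subset [DecidableEq Atom] {P : Finset Atom} {l : List (Formula Agent Atom)}
    (h : ∀ φ ∈ l, φ.atoms ⊆ P) : (conj l).atoms ⊆ P := by
  induction l with
  | nil => exact Finset.empty_subset P
  | cons a l ih =>
    exact Finset.union_subset (h a (by simp)) (ih fun φ hφ => h φ (by simp [hφ]))

lemma disj_atoms_subset [DecidableEq Atom] {P : Finset Atom} {l : List (Formula Agent Atom)}
    (h : ∀ φ ∈ l, φ.atoms ⊆ P) : (disj l).atoms ⊆ P := by
  induction l with
  | nil => exact Finset.empty_subset P
  | cons a l ih =>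
    exact Finset.union_subset (h a (by simp)) (ih fun φ hφ => h φ (by simp [hφ]))

lemma nabla_depth_le {B : Coalition Agent} {Φ : Finset (Formula Agent Atom)} {n : ℕ}
    (h : ∀ φ ∈ Φ, φ.depth ≤ n) : (nabla B Φ).depth ≤ n + 1 := by
  refine max_le (Nat.succ_le_succ (disj_depth_le ?_)) (conj_depth_le ?_)
  · simpa using h
  · simp only [List.mem_map, Finset.mem_toList, forall_exists_index, and_imp]
    rintro _ φ hφ rfl
    simpa [diam, depth] using h φ hφ

section Canonical

variable [DecidableEq Atom]

lemma minterm_depth_le (P S : Finset Atom) (n : ℕ) :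
    (minterm P S : Formula Agent Atom).depth ≤ n := by
  refine max_le (conj_depth_le ?_) (conj_depth_le ?_) <;>
    exact List.forall_mem_map.2 fun _ _ => Nat.zero_le n

lemma minterm_atoms_subset {P S : Finset Atom} (hS : S ⊆ P) :
    (minterm P S : Formula Agent Atom).atoms ⊆ P := by
  refine Finset.union_subset (conj_atoms_subset ?_) (conj_atoms_subset ?_)
  · simp only [List.mem_map, Finset.mem_toList, forall_exists_index, and_imp]
    rintro _ q hq rfl
    simpa [atoms] using hS hq
  · simp only [List.mem_map, Finset.mem_toList, forall_exists_index, and_imp, Finset.mem_sdiff]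
    rintro _ q hq - rfl
    simpa [atoms] using hq

lemma nabla_atoms_subset {B : Coalition Agent} {Φ : Finset (Formula Agent Atom)} {P : Finset Atom}
    (h : ∀ φ ∈ Φ, φ.atoms ⊆ P) : (nabla B Φ).atoms ⊆ P := by
  refine Finset.union_subset (disj_atoms_subset ?_) (conj_atoms_subset ?_)
  · simpa using h
  · simp only [List.mem_map, Finset.mem_toList, forall_exists_index, and_imp]
    rintro _ φ hφ rfl
    simpa [diam, atoms] using h φ hφ

variable [Fintype Agent]

lemma dCanonical_depth_le {P : Finset Atom} {k : ℕ} {δ : Formula Agent Atom}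
    (h : δ ∈ dCanonical P k) : δ.depth ≤ k := by
  induction k generalizing δ with
  | zero =>
    obtain ⟨S, -, rfl⟩ := h
    exact minterm_depth_le P S 0
  | succ k ih =>
    obtain ⟨S, -, Φ, hΦ, rfl⟩ := h
    refine max_le (minterm_depth_le P S _) (conj_depth_le ?_)
    simp only [List.mem_map, forall_exists_index, and_imp]
    rintro _ B - rfl
    exact nabla_depth_le fun φ hφ => ih (hΦ B φ hφ)

lemma dCanonical_atoms_subset {P : Finset Atom} {k : ℕ} {δ : Formula Agent Atom}
    (h : δ ∈ dCanonical P k) : δ.atoms ⊆ P := by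
  induction k generalizing δ with
  | zero =>
    obtain ⟨S, hS, rfl⟩ := h
    exact minterm_atoms_subset hS
  | succ k ih =>
    obtain ⟨S, hS, Φ, hΦ, rfl⟩ := h
    refine Finset.union_subset (minterm_atoms_subset hS) (conj_atoms_subset ?_)
    simp only [List.mem_map, forall_exists_index, and_imp]
    rintro _ B - rfl
    exact nabla_atoms_subset fun φ hφ => ih (hΦ B φ hφ)

/-- The inner negation of the diamond would be swallowed if `δ` were the bare atom `p`; a canonical
formula is always a conjunction. -/
lemma litElim_diam_of_dCanonical {P : Finset Atom} {k : ℕ} {δ : Formula Agent Atom}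
    (h : δ ∈ dCanonical P k) (p : Atom) (B : Coalition Agent) :
    (diam B δ).litElim p = diam B (δ.litElim p) := by
  cases k with
  | zero =>
    obtain ⟨S, -, rfl⟩ := h
    rfl
  | succ k =>
    obtain ⟨S, -, Φ, -, rfl⟩ := h
    rfl

/-- Needed to form covers of all realized types, and the disjunction that treats an arbitrary
formula. -/
lemma dCanonical_finite (P : Finset Atom) (k : ℕ) :
    (dCanonical P k : Set (Formula Agent Atom)).Finite := by
  classical
  induction k with
  | zero =>
    refine (P.powerset.finite_toSet.image (minterm P)).subset ?_
    rintro _ ⟨S, hS, rfl⟩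
    exact ⟨S, by simpa using hS, rfl⟩
  | succ k ih =>
    have hfin : {Φ : Coalition Agent → Finset (Formula Agent Atom) |
        ∀ B, Φ B ∈ ih.toFinset.powerset}.Finite :=
      Set.Finite.pi' fun _ => Finset.finite_toSet _
    refine (P.powerset.finite_toSet.image2 (fun S Φ => and (minterm P S)
      (conj ((Finset.univ : Finset (Coalition Agent)).toList.map fun B => nabla B (Φ B))))
      hfin).subset ?_
    rintro _ ⟨S, hS, Φ, hΦ, rfl⟩
    refine ⟨S, by simpa using hS, Φ, fun B => ?_, rfl⟩
    rw [Finset.mem_powerset]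
    intro η hη
    simpa using hΦ B η hη

end Canonical

/-- A tautology of a prescribed modal depth. -/
def depthPadding (B : Coalition Agent) : ℕ → Formula Agent Atom
  | 0 => top
  | n + 1 => dist B (depthPadding B n)

lemma depthPadding_depth (B : Coalition Agent) (n : ℕ) :
    (depthPadding B n : Formula Agent Atom).depth = n := by
  induction n with
  | zero => rfl
  | succ n ih => exact congrArg (· + 1) ih

lemma depthPadding_atoms [DecidableEq Atom] (B : Coalition Agent) (n : ℕ) :
    (depthPadding B n : Formula Agent Atom).atoms = ∅ := by
  induction n with
  | zero => rfl
  | succ n ih => exact ih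

end Formula

/-! ### Semantics of canonical formulas and of their literal eliminations. -/

namespace Model

open Formula

variable {Agent : Type w} {Atom : Type u}

lemma sat_conj (M : Model Agent Atom) (s : M.World) (l : List (Formula Agent Atom)) :
    M.Sat s (conj l) ↔ ∀ φ ∈ l, M.Sat s φ := by
  induction l with
  | nil => simp [conj, Sat]
  | cons a l ih =>
    rw [List.forall_mem_cons, ← ih]
    rfl

lemma sat_disj (M : Model Agent Atom) (s : M.World) (l : List (Formula Agent Atom)) :
    M.Sat s (disj l) ↔ ∃ φ ∈ l, M.Sat s φ := by
  induction l with
  | nil => simp [disj, Sat]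
  | cons a l ih =>
    simp only [List.mem_cons, exists_eq_or_imp, ← ih]
    rfl

lemma sat_diam (M : Model Agent Atom) (s : M.World) (B : Coalition Agent)
    (φ : Formula Agent Atom) :
    M.Sat s (diam B φ) ↔ ∃ t, M.groupRel B s t ∧ M.Sat t φ := by
  simp [diam, Sat]

lemma sat_nabla (M : Model Agent Atom) (s : M.World) (B : Coalition Agent)
    (Φ : Finset (Formula Agent Atom)) :
    M.Sat s (nabla B Φ) ↔ (∀ t, M.groupRel B s t → ∃ φ ∈ Φ, M.Sat t φ) ∧
      ∀ φ ∈ Φ, ∃ t, M.groupRel B s t ∧ M.Sat t φ := by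
  simp only [nabla, Sat, sat_conj, sat_disj, List.mem_map, Finset.mem_toList,
    forall_exists_index, and_imp, forall_apply_eq_imp_iff₂, sat_diam]

lemma sat_depthPadding (M : Model Agent Atom) (s : M.World) (B : Coalition Agent) (n : ℕ) :
    M.Sat s (depthPadding B n) := by
  induction n generalizing s with
  | zero => trivial
  | succ n ih => exact fun t _ => ih t

section Canonical

variable [DecidableEq Atom]

lemma sat_minterm {M : Model Agent Atom} {s : M.World} {P S : Finset Atom} (hS : S ⊆ P) :
    M.Sat s (minterm P S) ↔ ∀ q ∈ P, (q ∈ M.val s ↔ q ∈ S) := by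
  simp only [minterm, Sat, sat_conj, List.forall_mem_map, Finset.mem_toList, Finset.mem_sdiff, and_imp]
  constructor
  · rintro ⟨h₁, h₂⟩ q hq
    exact ⟨fun h => by_contra fun h' => h₂ q hq h' h, h₁ q⟩
  · intro h
    exact ⟨fun q hq => (h q (hS hq)).2 hq, fun q hq hq' h' => hq' ((h q hq).1 h')⟩

lemma sat_litElim_minterm {M : Model Agent Atom} {s : M.World} {P S : Finset Atom} {p : Atom}
    (hS : S ⊆ P) :
    M.Sat s ((minterm P S).litElim p) ↔ ∀ q ∈ P, q ≠ p → (q ∈ M.val s ↔ q ∈ S) := by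
  have h₁ : ∀ q, M.Sat s ((atom q : Formula Agent Atom).litElim p) ↔ (q ≠ p → q ∈ M.val s) := by
    intro q
    by_cases h : q = p <;> simp [litElim_atom, h, Sat]
  have h₂ : ∀ q, M.Sat s ((neg (atom q) : Formula Agent Atom).litElim p) ↔
      (q ≠ p → q ∉ M.val s) := by
    intro q
    by_cases h : q = p <;> simp [litElim_neg_atom, h, Sat]
  simp only [minterm, litElim_and, litElim_conj, Sat, sat_conj, List.forall_mem_map,
    Finset.mem_toList, Finset.mem_sdiff, and_imp, h₁, h₂]
  constructor
  · rintro ⟨h₁, h₂⟩ q hq hp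
    exact ⟨fun h => by_contra fun h' => h₂ q hq h' hp h, fun h => h₁ q h hp⟩
  · intro h
    exact ⟨fun q hq hp => (h q (hS hq) hp).2 hq, fun q hq hq' hp h' => hq' ((h q hq hp).1 h')⟩

variable [Fintype Agent]

lemma sat_dCanonical_succ {M : Model Agent Atom} {s : M.World} {P S : Finset Atom}
    {Φ : Coalition Agent → Finset (Formula Agent Atom)} :
    M.Sat s (and (minterm P S)
      (conj ((Finset.univ : Finset (Coalition Agent)).toList.map fun B => nabla B (Φ B)))) ↔
    M.Sat s (minterm P S) ∧ ∀ B, (∀ t, M.groupRel B s t → ∃ φ ∈ Φ B, M.Sat t φ) ∧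
      ∀ φ ∈ Φ B, ∃ t, M.groupRel B s t ∧ M.Sat t φ := by
  simp only [Sat, sat_conj, List.mem_map, Finset.mem_toList, Finset.mem_univ, true_and,
    forall_exists_index, forall_apply_eq_imp_iff, sat_nabla]

lemma sat_litElim_dCanonical_succ {M : Model Agent Atom} {s : M.World} {P S : Finset Atom}
    {Φ : Coalition Agent → Finset (Formula Agent Atom)} {k : ℕ} {p : Atom}
    (hΦ : ∀ B, ∀ η ∈ Φ B, η ∈ dCanonical P k) :
    M.Sat s ((and (minterm P S)
      (conj ((Finset.univ : Finset (Coalition Agent)).toList.map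
        fun B => nabla B (Φ B)))).litElim p) ↔
    M.Sat s ((minterm P S).litElim p) ∧
      ∀ B, (∀ t, M.groupRel B s t → ∃ φ ∈ Φ B, M.Sat t (φ.litElim p)) ∧
        ∀ φ ∈ Φ B, ∃ t, M.groupRel B s t ∧ M.Sat t (φ.litElim p) := by
  have hdiam : ∀ B, ∀ φ ∈ Φ B, (M.Sat s ((diam B φ).litElim p) ↔
      ∃ t, M.groupRel B s t ∧ M.Sat t (φ.litElim p)) := fun B φ hφ => by
    rw [litElim_diam_of_dCanonical (hΦ B φ hφ), sat_diam]
  have hdist : ∀ B, M.Sat s ((dist B (disj (Φ B).toList)).litElim p) ↔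
      ∀ t, M.groupRel B s t → ∃ φ ∈ Φ B, M.Sat t (φ.litElim p) := fun B => by
    change (∀ t, M.groupRel B s t → M.Sat t ((disj (Φ B).toList).litElim p)) ↔ _
    simp [litElim_disj, sat_disj]
  simp only [litElim_and, litElim_conj, Sat, sat_conj, List.mem_map, Finset.mem_toList,
    Finset.mem_univ, true_and, forall_exists_index, and_imp, forall_apply_eq_imp_iff,
    forall_apply_eq_imp_iff₂, nabla, hdist]
  exact and_congr_right fun _ => forall_congr' fun B => and_congr_right fun _ =>
    forall₂_congr (hdiam B)

/-- Diamonds and boxes are monotone, and outside them a canonical formula has only conjunctions,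
disjunctions and literals, so turning literals into `⊤` weakens it. -/
lemma sat_litElim_of_sat {P : Finset Atom} {k : ℕ} {δ : Formula Agent Atom} {p : Atom}
    {M : Model Agent Atom} {s : M.World} (hδ : δ ∈ dCanonical P k) (h : M.Sat s δ) :
    M.Sat s (δ.litElim p) := by
  induction k generalizing δ s with
  | zero =>
    obtain ⟨S, hS, rfl⟩ := hδ
    exact (sat_litElim_minterm hS).2 fun q hq _ => (sat_minterm hS).1 h q hq
  | succ k ih =>
    obtain ⟨S, hS, Φ, hΦ, rfl⟩ := hδ
    rw [sat_dCanonical_succ] at h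
    rw [sat_litElim_dCanonical_succ hΦ]
    refine ⟨(sat_litElim_minterm hS).2 fun q hq _ => (sat_minterm hS).1 h.1 q hq, fun B => ⟨?_, ?_⟩⟩
    · intro t ht
      obtain ⟨φ, hφ, hs⟩ := (h.2 B).1 t ht
      exact ⟨φ, hφ, ih (hΦ B φ hφ) hs⟩
    · intro φ hφ
      obtain ⟨t, ht, hs⟩ := (h.2 B).2 φ hφ
      exact ⟨t, ht, ih (hΦ B φ hφ) hs⟩

lemma exists_dCanonical_sat (P : Finset Atom) (k : ℕ) (M : Model Agent Atom) (s : M.World) :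
    ∃ δ ∈ dCanonical P k, M.Sat s δ := by
  classical
  have hmin : ∀ s, M.Sat s (minterm P (P.filter (· ∈ M.val s))) := fun s =>
    (sat_minterm (Finset.filter_subset _ _)).2 fun q hq => by simp [hq]
  induction k generalizing s with
  | zero => exact ⟨_, ⟨_, Finset.filter_subset _ _, rfl⟩, hmin s⟩
  | succ k ih =>
    -- The cover for `B` consists of all canonical types realized at some `B`-successor.
    let Φ : Coalition Agent → Finset (Formula Agent Atom) := fun B =>
      (dCanonical_finite P k).toFinset.filter fun η => ∃ t, M.groupRel B s t ∧ M.Sat t η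
    refine ⟨_, ⟨P.filter (· ∈ M.val s), Finset.filter_subset _ _, Φ, ?_, rfl⟩, ?_⟩
    · intro B η hη
      simpa using (Finset.mem_filter.1 hη).1
    · rw [sat_dCanonical_succ]
      refine ⟨hmin s, fun B => ⟨fun t ht => ?_, fun φ hφ => (Finset.mem_filter.1 hφ).2⟩⟩
      obtain ⟨δ, hδ, hs⟩ := ih t
      exact ⟨δ, Finset.mem_filter.2 ⟨by simpa using hδ, t, ht, hs⟩, hs⟩

end Canonical

/-! ### Bisimilarity up to finite depth, and its behaviour in transitive Euclidean models. -/

/-- Collective bisimilarity up to a finite modal depth, with respect to the atoms in `Q`. -/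
def BisimUpTo (Q : Set Atom) (M N : Model Agent Atom) : ℕ → M.World → N.World → Prop
  | 0, x, y => ∀ q ∈ Q, (q ∈ M.val x ↔ q ∈ N.val y)
  | l + 1, x, y => (∀ q ∈ Q, (q ∈ M.val x ↔ q ∈ N.val y)) ∧
      ∀ C : Coalition Agent,
        (∀ v, M.groupRel C x v → ∃ v', N.groupRel C y v' ∧ BisimUpTo Q M N l v v') ∧
        ∀ v', N.groupRel C y v' → ∃ v, M.groupRel C x v ∧ BisimUpTo Q M N l v v'

namespace BisimUpTo

variable {Q : Set Atom} {M N : Model Agent Atom} {x v : M.World} {y v' : N.World} {l m : ℕ}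

lemma atoms (h : BisimUpTo Q M N l x y) : ∀ q ∈ Q, (q ∈ M.val x ↔ q ∈ N.val y) := by
  cases l with
  | zero => exact h
  | succ l => exact h.1

lemma of_succ (h : BisimUpTo Q M N (l + 1) x y) : BisimUpTo Q M N l x y := by
  induction l generalizing x y with
  | zero => exact h.1
  | succ l ih =>
    refine ⟨h.1, fun C => ⟨fun v hv => ?_, fun v' hv' => ?_⟩⟩
    · obtain ⟨v', hv', hb⟩ := (h.2 C).1 v hv
      exact ⟨v', hv', ih hb⟩
    · obtain ⟨v, hv, hb⟩ := (h.2 C).2 v' hv'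
      exact ⟨v, hv, ih hb⟩

lemma mono (hlm : l ≤ m) (h : BisimUpTo Q M N m x y) : BisimUpTo Q M N l x y := by
  induction hlm with
  | refl => exact h
  | step _ ih => exact ih h.of_succ

lemma sat_iff [DecidableEq Atom] {φ : Formula Agent Atom} (h : BisimUpTo Q M N l x y)
    (hQ : ∀ q ∈ φ.atoms, q ∈ Q) (hl : φ.depth ≤ l) : M.Sat x φ ↔ N.Sat y φ := by
  induction φ generalizing l x y with
  | atom q => exact h.atoms q (hQ q (by simp [Formula.atoms]))
  | top => rfl
  | bot => rfl
  | neg φ ih => exact not_congr (ih h hQ hl)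
  | and φ ψ ih₁ ih₂ =>
    exact and_congr (ih₁ h (fun q hq => hQ q (Finset.mem_union_left _ hq))
        ((le_max_left _ _).trans hl))
      (ih₂ h (fun q hq => hQ q (Finset.mem_union_right _ hq)) ((le_max_right _ _).trans hl))
  | or φ ψ ih₁ ih₂ =>
    exact or_congr (ih₁ h (fun q hq => hQ q (Finset.mem_union_left _ hq))
        ((le_max_left _ _).trans hl))
      (ih₂ h (fun q hq => hQ q (Finset.mem_union_right _ hq)) ((le_max_right _ _).trans hl))
  | dist B φ ih =>
    cases l with
    | zero => exact absurd hl (Nat.not_succ_le_zero _)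
    | succ l =>
      have hl' : φ.depth ≤ l := Nat.le_of_succ_le_succ hl
      constructor
      · intro hs v' hv'
        obtain ⟨v, hv, hb⟩ := (h.2 B).2 v' hv'
        exact (ih hb hQ hl').1 (hs v hv)
      · intro hs v hv
        obtain ⟨v', hv', hb⟩ := (h.2 B).1 v hv
        exact (ih hb hQ hl').2 (hs v' hv')

/-- Both worlds obey the same covers: the box part assigns a member of the cover to each successor,
and the diamond part realizes that member on the other side. -/
lemma of_dCanonical [Fintype Agent] [DecidableEq Atom] {P : Finset Atom} {k : ℕ}
    {δ : Formula Agent Atom} {p : Atom} (hδ : δ ∈ dCanonical P k) (hM : M.Sat x (δ.litElim p))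
    (hN : N.Sat y δ) : BisimUpTo {q | q ∈ P ∧ q ≠ p} M N k x y := by
  have hmin : ∀ {S : Finset Atom} {x : M.World} {y : N.World}, S ⊆ P →
      M.Sat x ((minterm P S).litElim p) → N.Sat y (minterm P S) →
      ∀ q ∈ {q | q ∈ P ∧ q ≠ p}, (q ∈ M.val x ↔ q ∈ N.val y) := by
    rintro S x y hS hM hN q ⟨hq, hp⟩
    rw [(sat_litElim_minterm hS).1 hM q hq hp, (sat_minterm hS).1 hN q hq]
  induction k generalizing δ x y with
  | zero =>
    obtain ⟨S, hS, rfl⟩ := hδ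
    exact hmin hS hM hN
  | succ k ih =>
    obtain ⟨S, hS, Φ, hΦ, rfl⟩ := hδ
    rw [sat_dCanonical_succ] at hN
    rw [sat_litElim_dCanonical_succ hΦ] at hM
    refine ⟨hmin hS hM.1 hN.1, fun C => ⟨fun v hv => ?_, fun v' hv' => ?_⟩⟩
    · obtain ⟨φ, hφ, hs⟩ := (hM.2 C).1 v hv
      obtain ⟨v', hv', hs'⟩ := (hN.2 C).2 φ hφ
      exact ⟨v', hv', ih (hΦ C φ hφ) hs hs'⟩
    · obtain ⟨φ, hφ, hs'⟩ := (hN.2 C).1 v' hv'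
      obtain ⟨v, hv, hs⟩ := (hM.2 C).2 φ hφ
      exact ⟨v, hv, ih (hΦ C φ hφ) hs hs'⟩

end BisimUpTo

/-- A successor has the same successors as its predecessor in a transitive Euclidean relation. -/
lemma rel_congr_left {M : Model Agent Atom} (ht : M.IsTransitive) (he : M.IsEuclidean) {i : Agent}
    {x v : M.World} (h : M.rel i x v) (t : M.World) : M.rel i v t ↔ M.rel i x t :=
  ⟨ht i x v t h, he i x v t h⟩

/-- Worlds related by every agent's relation agree on all successors, so bisimilarity between them
can be raised to the level of their predecessors. -/
lemma BisimUpTo.of_forall_rel {Q : Set Atom} {M N : Model Agent Atom} {x v : M.World}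
    {y v' : N.World} {l : ℕ} (htM : M.IsTransitive) (heM : M.IsEuclidean) (htN : N.IsTransitive)
    (heN : N.IsEuclidean) (h : BisimUpTo Q M N (l + 1) x y) (hx : ∀ i, M.rel i x v)
    (hy : ∀ i, N.rel i y v') (hv : BisimUpTo Q M N l v v') : BisimUpTo Q M N (l + 1) v v' := by
  have h₁ : ∀ C t, M.groupRel C v t ↔ M.groupRel C x t := fun C t =>
    forall₂_congr fun i _ => rel_congr_left htM heM (hx i) t
  have h₂ : ∀ C t, N.groupRel C v' t ↔ N.groupRel C y t := fun C t =>
    forall₂_congr fun i _ => rel_congr_left htN heN (hy i) t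
  refine ⟨hv.atoms, fun C => ?_⟩
  simpa only [h₁, h₂] using h.2 C

/-- The successors of `x` and of `y` for agent `i` realize the same types up to depth `l`. -/
def RelMatch (Q : Set Atom) (M N : Model Agent Atom) (i : Agent) (l : ℕ) (x : M.World)
    (y : N.World) : Prop :=
  (∀ v, M.rel i x v → ∃ v', N.rel i y v' ∧ BisimUpTo Q M N l v v') ∧
    ∀ v', N.rel i y v' → ∃ v, M.rel i x v ∧ BisimUpTo Q M N l v v'

lemma groupRel_singleton {M : Model Agent Atom} {i : Agent} {x v : M.World} :
    M.groupRel ⟨{i}, Finset.singleton_nonempty i⟩ x v ↔ M.rel i x v := by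
  simp [groupRel]

lemma BisimUpTo.relMatch {Q : Set Atom} {M N : Model Agent Atom} {x : M.World} {y : N.World}
    {l m : ℕ} (h : BisimUpTo Q M N m x y) (hlm : l < m) (i : Agent) : RelMatch Q M N i l x y := by
  simpa only [groupRel_singleton, RelMatch] using
    (h.mono (Nat.succ_le_of_lt hlm)).2 ⟨{i}, Finset.singleton_nonempty i⟩

/-- Agent `i` has the same successors after its own move, so its synchronization depth need not
drop. This is what lets labels be constant along a relation. -/
lemma RelMatch.congr {Q : Set Atom} {M N : Model Agent Atom} {i : Agent} {l : ℕ} {x v : M.World}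
    {y v' : N.World} (htM : M.IsTransitive) (heM : M.IsEuclidean) (htN : N.IsTransitive)
    (heN : N.IsEuclidean) (h : RelMatch Q M N i l x y) (hx : M.rel i x v) (hy : N.rel i y v') :
    RelMatch Q M N i l v v' := by
  simpa only [RelMatch, rel_congr_left htM heM hx, rel_congr_left htN heN hy] using h

end Model

/-! ### The amalgam of two models for two agents. -/

namespace Model

open Formula

variable {Atom : Type u}

/-- The worlds of the amalgam of `M` and `N`: pairs of worlds together with, for each of the two
agents, the depth up to which the successors of the two components are synchronized. -/
structure AmalgamWorld (Q : Set Atom) (M N : Model (Fin 2) Atom) : Type u where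
  fst : M.World
  snd : N.World
  label : Fin 2 → ℕ
  label_le : ∀ i j, label i ≤ label j + 1
  bisim : (∃ i, label i ≠ 0) → ∀ l, (∀ i, l ≤ label i) → BisimUpTo Q M N l fst snd
  relMatch : ∀ i l, label i = l + 1 → RelMatch Q M N i l fst snd

/-- The amalgam of `M` and `N`: the atom `p` is evaluated in `N` and the other atoms in `M`. -/
def amalgam (Q : Set Atom) (p : Atom) (M N : Model (Fin 2) Atom) (a : AmalgamWorld Q M N) :
    Model (Fin 2) Atom where
  World := AmalgamWorld Q M N
  nonempty := ⟨a⟩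
  rel i b c := b.label i = c.label i ∧ M.rel i b.fst c.fst ∧
    (b.label i ≠ 0 → N.rel i b.snd c.snd)
  val b := {q | (q = p ∧ q ∈ N.val b.snd) ∨ (q ≠ p ∧ q ∈ M.val b.fst)}

lemma coalition_fin_two (C : Coalition (Fin 2)) :
    (∃ i, C = ⟨{i}, Finset.singleton_nonempty i⟩) ∨ C = ⟨Finset.univ, Finset.univ_nonempty⟩ := by
  revert C
  decide

lemma groupRel_univ {M : Model (Fin 2) Atom} {x v : M.World} :
    M.groupRel ⟨Finset.univ, Finset.univ_nonempty⟩ x v ↔ ∀ i, M.rel i x v := by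
  simp [groupRel]

section Amalgam

variable {Q : Set Atom} {p : Atom} {M N : Model (Fin 2) Atom} {r : AmalgamWorld Q M N}

/-- The label of `i` is the same at all three worlds, so the condition on `N` is in force for all
the moves or for none. -/
lemma amalgam_isTransitive (hM : M.IsTransitive) (hN : N.IsTransitive) :
    (amalgam Q p M N r).IsTransitive := by
  rintro i a b c ⟨h₁, h₂, h₃⟩ ⟨h₁', h₂', h₃'⟩
  exact ⟨h₁.trans h₁', hM i _ _ _ h₂ h₂', fun h => hN i _ _ _ (h₃ h) (h₃' (h₁ ▸ h))⟩

lemma amalgam_isEuclidean (hM : M.IsEuclidean) (hN : N.IsEuclidean) :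
    (amalgam Q p M N r).IsEuclidean := by
  rintro i a b c ⟨h₁, h₂, h₃⟩ ⟨h₁', h₂', h₃'⟩
  exact ⟨h₁.symm.trans h₁', hM i _ _ _ h₂ h₂',
    fun h => hN i _ _ _ (h₃ (h₁.symm ▸ h)) (h₃' (h₁.symm ▸ h))⟩

lemma amalgam_isReflexive (hM : M.IsReflexive) (hN : N.IsReflexive) :
    (amalgam Q p M N r).IsReflexive :=
  fun i a => ⟨rfl, hM i a.fst, fun _ => hN i a.snd⟩

variable (htM : M.IsTransitive) (heM : M.IsEuclidean) (htN : N.IsTransitive) (heN : N.IsEuclidean)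

include htM heM htN heN

/-- A move of one agent in the amalgam to a prescribed pair of worlds. -/
lemma exists_amalgam_rel (a : AmalgamWorld Q M N) {i : Fin 2} {v : M.World} {v' : N.World}
    (hv : M.rel i a.fst v)
    (hv' : ∀ l, a.label i = l + 1 → N.rel i a.snd v' ∧ BisimUpTo Q M N l v v') :
    ∃ b : AmalgamWorld Q M N, (amalgam Q p M N r).rel i a b ∧ b.fst = v ∧ b.snd = v' := by
  obtain ⟨j, hj⟩ : ∃ j : Fin 2, j ≠ i := exists_ne i
  rcases hl : a.label i with _ | l
  -- At label 0 agent `i` imposes nothing on `N`, so all synchronization may be dropped.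
  · refine ⟨⟨v, v', fun _ => 0, by simp, by simp, by simp⟩, ⟨hl, hv, fun h => (h hl).elim⟩, rfl, rfl⟩
  · obtain ⟨hr, hb⟩ := hv' l hl
    -- Agent `i` must keep `l + 1`; the pair matches only to depth `l`, which is what the other
    -- agent gets.
    refine ⟨⟨v, v', fun k => if k = i then l + 1 else l, ?_, ?_, ?_⟩,
      ⟨by simpa using hl, hv, fun _ => hr⟩, rfl, rfl⟩
    · intro k k'
      split_ifs <;> omega
    · intro _ m hm
      have := hm j
      rw [if_neg hj] at this
      exact hb.mono this
    · intro k m hm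
      split_ifs at hm with hk
      · obtain rfl : l = m := by omega
        subst hk
        exact (a.relMatch k l hl).congr htM heM htN heN hv hr
      -- A positive label `l = m + 1` of the other agent asks for a match to depth `m` only, one
      -- below the bisimilarity of the new pair.
      · exact hb.relMatch (by omega) k

/-- A joint move of both agents in the amalgam to a prescribed pair of worlds. -/
lemma exists_amalgam_rel_forall (a : AmalgamWorld Q M N) {v : M.World} {v' : N.World}
    (hv : ∀ i, M.rel i a.fst v) (hv' : ∀ i, a.label i ≠ 0 → N.rel i a.snd v')
    (hb : (∃ i, a.label i ≠ 0) → ∀ l, (∀ i, l ≤ a.label i) → BisimUpTo Q M N l v v') :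
    ∃ b : AmalgamWorld Q M N,
      (∀ i, (amalgam Q p M N r).rel i a b) ∧ b.fst = v ∧ b.snd = v' :=
  ⟨⟨v, v', a.label, a.label_le, hb, fun i l hl =>
    (a.relMatch i l hl).congr htM heM htN heN (hv i) (hv' i (by omega))⟩,
    fun i => ⟨rfl, hv i, hv' i⟩, rfl, rfl⟩

/-- Lifts moves of `M` along the first projection; the second component comes from the
synchronization data. -/
lemma exists_amalgam_groupRel (a : AmalgamWorld Q M N) {C : Coalition (Fin 2)} {v : M.World}
    (hv : M.groupRel C a.fst v) :
    ∃ b : AmalgamWorld Q M N, (amalgam Q p M N r).groupRel C a b ∧ b.fst = v := by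
  rcases coalition_fin_two C with ⟨i, rfl⟩ | rfl
  · rw [groupRel_singleton] at hv
    obtain ⟨v', hv'⟩ : ∃ v', ∀ l, a.label i = l + 1 →
        N.rel i a.snd v' ∧ BisimUpTo Q M N l v v' := by
      rcases hl : a.label i with _ | l
      · exact ⟨a.snd, by simp⟩
      · obtain ⟨v', h⟩ := (a.relMatch i l hl).1 v hv
        refine ⟨v', fun m hm => ?_⟩
        obtain rfl : l = m := by omega
        exact h
    obtain ⟨b, hb, h, -⟩ := exists_amalgam_rel htM heM htN heN a hv hv'
    exact ⟨b, groupRel_singleton.2 hb, h⟩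
  · rw [groupRel_univ] at hv
    obtain ⟨v', hv', hb⟩ : ∃ v', (∀ i, a.label i ≠ 0 → N.rel i a.snd v') ∧
        ((∃ i, a.label i ≠ 0) → ∀ l, (∀ i, l ≤ a.label i) → BisimUpTo Q M N l v v') := by
      by_cases h₀ : ∃ i, a.label i ≠ 0
      · by_cases h₁ : ∃ j, a.label j = 0
        · obtain ⟨i, hi⟩ := h₀
          obtain ⟨j, hj⟩ := h₁
          -- Labels 1 and 0: depth 0 bisimilarity yields no joint move in `N`, but only agent `i`
          -- needs one there, and its own match supplies it.
          have hi' : a.label i = 0 + 1 := by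
            have := a.label_le i j
            omega
          obtain ⟨v', hr, hb⟩ := (a.relMatch i 0 hi').1 v (hv i)
          refine ⟨v', fun k hk => ?_, fun _ l hl => hb.mono (hj ▸ hl j)⟩
          obtain rfl : k = i := by
            have : j ≠ i := by rintro rfl; exact hi hj
            have : j ≠ k := by rintro rfl; exact hk hj
            omega
          exact hr
        · push Not at h₁
          have hpos : ∀ i, 1 ≤ a.label i := fun i => Nat.one_le_iff_ne_zero.2 (h₁ i)
          obtain ⟨n, hn⟩ : ∃ n, min (a.label 0) (a.label 1) = n + 1 :=
            Nat.exists_eq_add_one.2 (lt_min (hpos 0) (hpos 1))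
          have hxy : BisimUpTo Q M N (n + 1) a.fst a.snd :=
            a.bisim h₀ _ (Fin.forall_fin_two.2 ⟨by omega, by omega⟩)
          obtain ⟨v', hr, hb⟩ :=
            (hxy.2 ⟨Finset.univ, Finset.univ_nonempty⟩).1 v (groupRel_univ.2 hv)
          rw [groupRel_univ] at hr
          refine ⟨v', fun i _ => hr i, fun _ l hl => ?_⟩
          -- The joint step costs one level, which is regained because all successors are shared
          -- with the predecessors.
          refine (hxy.of_forall_rel htM heM htN heN hv hr hb).mono ?_
          have := hl 0
          have := hl 1
          omega
      -- With both labels 0 the second component is arbitrary.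
      · exact ⟨a.snd, fun i hi => (h₀ ⟨i, hi⟩).elim, fun h => (h₀ h).elim⟩
    obtain ⟨b, hb, h, -⟩ := exists_amalgam_rel_forall htM heM htN heN a hv hv' hb
    exact ⟨b, groupRel_univ.2 hb, h⟩

lemma amalgam_isSerial (hM : M.IsSerial) : (amalgam Q p M N r).IsSerial := by
  intro i a
  obtain ⟨v, hv⟩ := hM i a.fst
  obtain ⟨b, hb, -⟩ := exists_amalgam_groupRel (p := p) (r := r) htM heM htN heN a
    (groupRel_singleton.2 hv)
  exact ⟨b, groupRel_singleton.1 hb⟩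

lemma amalgam_colBisimilar (a : AmalgamWorld Q M N) :
    ColBisimilar p (amalgam Q p M N r) a M a.fst := by
  refine ⟨fun b x => b.fst = x, rfl, ?_, ?_, ?_⟩
  · rintro b _ rfl q hq
    simp [amalgam, hq]
  · rintro b _ rfl C c hc
    exact ⟨c.fst, fun i hi => (hc i hi).2.1, rfl⟩
  · rintro b _ rfl C x hx
    exact exists_amalgam_groupRel htM heM htN heN b hx

/-- A move of `i` preserves its label, at least `l + 1`; as labels differ by at most one, all labels
stay at least `l`. Positive labels also force the move to be one of `N`. -/
lemma amalgam_bisimUpTo {l : ℕ} (a : AmalgamWorld Q M N) (hl : ∀ i, l ≤ a.label i)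
    (ha : BisimUpTo Q M N l a.fst a.snd) :
    BisimUpTo {q | q ∈ Q ∨ q = p} (amalgam Q p M N r) N l a a.snd := by
  have hval : ∀ a : AmalgamWorld Q M N, ∀ {l}, BisimUpTo Q M N l a.fst a.snd →
      ∀ q ∈ {q | q ∈ Q ∨ q = p}, (q ∈ (amalgam Q p M N r).val a ↔ q ∈ N.val a.snd) := by
    intro a l ha q hq
    by_cases h : q = p
    · simp [amalgam, h]
    · simpa [amalgam, h] using ha.atoms q (hq.resolve_right h)
  induction l generalizing a with
  | zero => exact hval a ha
  | succ l ih =>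
    have hlabel : ∀ {i} {b : AmalgamWorld Q M N}, (amalgam Q p M N r).rel i a b →
        (∃ k, b.label k ≠ 0) ∧ ∀ k, l ≤ b.label k := by
      intro i b hb
      have h₁ : a.label i = b.label i := hb.1
      have h₂ := hl i
      refine ⟨⟨i, by omega⟩, fun k => ?_⟩
      have := b.label_le i k
      omega
    refine ⟨hval a ha, fun C => ⟨fun b hb => ?_, fun v' hv' => ?_⟩⟩
    · obtain ⟨i, hi⟩ := C.2
      obtain ⟨h₀, h⟩ := hlabel (hb i hi)
      exact ⟨b.snd, fun k hk => (hb k hk).2.2 (by have := hl k; omega), ih b h (b.bisim h₀ l h)⟩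
    · rcases coalition_fin_two C with ⟨i, rfl⟩ | rfl
      · rw [groupRel_singleton] at hv'
        obtain ⟨m, hm⟩ : ∃ m, a.label i = m + 1 := Nat.exists_eq_add_one.2 (by have := hl i; omega)
        obtain ⟨v, hv, hb⟩ := (a.relMatch i m hm).2 v' hv'
        obtain ⟨b, hab, -, rfl⟩ := exists_amalgam_rel (p := p) (r := r) htM heM htN heN a hv
          fun n hn => ⟨hv', by obtain rfl : m = n := by omega
                               exact hb⟩
        obtain ⟨h₀, h⟩ := hlabel hab
        exact ⟨b, groupRel_singleton.2 hab, ih b h (b.bisim h₀ l h)⟩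
      · rw [groupRel_univ] at hv'
        obtain ⟨n, hn⟩ : ∃ n, min (a.label 0) (a.label 1) = n + 1 :=
          Nat.exists_eq_add_one.2 (lt_min (by have := hl 0; omega) (by have := hl 1; omega))
        have hxy : BisimUpTo Q M N (n + 1) a.fst a.snd :=
          a.bisim ⟨0, by have := hl 0; omega⟩ _ (Fin.forall_fin_two.2 ⟨by omega, by omega⟩)
        obtain ⟨v, hv, hb⟩ :=
          (hxy.2 ⟨Finset.univ, Finset.univ_nonempty⟩).2 v' (groupRel_univ.2 hv')
        rw [groupRel_univ] at hv
        obtain ⟨b, hab, -, rfl⟩ := exists_amalgam_rel_forall (p := p) (r := r) htM heM htN heN a hv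
          (fun i _ => hv' i) fun _ m hm =>
            (hxy.of_forall_rel htM heM htN heN hv hv' hb).mono
              (by have := hm 0; have := hm 1; omega)
        obtain ⟨h₀, h⟩ := hlabel (hab 0)
        exact ⟨b, groupRel_univ.2 hab, ih b h (b.bisim h₀ l h)⟩

end Amalgam

end Model

/-! ### Invariance under collective `p`-bisimulation. -/

namespace ColBisimilar

variable {Agent : Type w} {Atom : Type u} {p : Atom} {M M' : Model Agent Atom} {s : M.World}
  {s' : M'.World}

lemma refl (p : Atom) (M : Model Agent Atom) (s : M.World) : ColBisimilar p M s M s := by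
  refine ⟨Eq, rfl, ?_, ?_, ?_⟩
  · rintro v _ rfl q -
    rfl
  · rintro v _ rfl C t ht
    exact ⟨t, ht, rfl⟩
  · rintro v _ rfl C t ht
    exact ⟨t, ht, rfl⟩

lemma sat_iff [DecidableEq Atom] (h : ColBisimilar p M s M' s') {φ : Formula Agent Atom}
    (hp : p ∉ φ.atoms) : M.Sat s φ ↔ M'.Sat s' φ := by
  obtain ⟨ρ, hρ⟩ := h
  have key : ∀ v v', ρ v v' → (M.Sat v φ ↔ M'.Sat v' φ) := by
    induction φ with
    | atom q =>
      intro v v' h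
      exact hρ.atoms v v' h q fun hq => hp (by simp [Formula.atoms, hq])
    | top => exact fun _ _ _ => Iff.rfl
    | bot => exact fun _ _ _ => Iff.rfl
    | neg φ ih => exact fun v v' h => not_congr (ih hp v v' h)
    | and φ ψ ih₁ ih₂ =>
      exact fun v v' h => and_congr (ih₁ (fun hq => hp (Finset.mem_union_left _ hq)) v v' h)
        (ih₂ (fun hq => hp (Finset.mem_union_right _ hq)) v v' h)
    | or φ ψ ih₁ ih₂ =>
      exact fun v v' h => or_congr (ih₁ (fun hq => hp (Finset.mem_union_left _ hq)) v v' h)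
        (ih₂ (fun hq => hp (Finset.mem_union_right _ hq)) v v' h)
    | dist B φ ih =>
      intro v v' h
      constructor
      · intro hs t' ht'
        obtain ⟨t, ht, hr⟩ := hρ.back v v' h B t' ht'
        exact (ih hp t t' hr).1 (hs t ht)
      · intro hs t ht
        obtain ⟨t', ht', hr⟩ := hρ.forth v v' h B t ht
        exact (ih hp t t' hr).2 (hs t' ht')
  exact key s s' hρ.base

end ColBisimilar

/-! ### Forgetting and uniform interpolation. -/

namespace ModalSystem

open Model Formula

variable {Atom : Type u}

lemma IsModel.isTransitive {Agent : Type w} {L : ModalSystem} {M : Model Agent Atom}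
    (h : L.IsModel M) : M.IsTransitive := by
  cases L
  exacts [h.1, h.2.1, h.2.2.1]

lemma IsModel.isEuclidean {Agent : Type w} {L : ModalSystem} {M : Model Agent Atom}
    (h : L.IsModel M) : M.IsEuclidean := by
  cases L
  exacts [h.2, h.2.2, h.2.2.2]

lemma IsModel.amalgam {L : ModalSystem} {M N : Model (Fin 2) Atom} (hM : L.IsModel M)
    (hN : L.IsModel N) (Q : Set Atom) (p : Atom) (r : AmalgamWorld Q M N) :
    L.IsModel (amalgam Q p M N r) := by
  have ht := amalgam_isTransitive (p := p) (r := r) hM.isTransitive hN.isTransitive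
  have he := amalgam_isEuclidean (p := p) (r := r) hM.isEuclidean hN.isEuclidean
  have hs := amalgam_isSerial (p := p) (r := r) hM.isTransitive hM.isEuclidean
    hN.isTransitive hN.isEuclidean
  cases L
  · exact ⟨ht, he⟩
  · exact ⟨hs hM.1, ht, he⟩
  · exact ⟨hs hM.1, amalgam_isReflexive hM.2.1 hN.2.1, ht, he⟩

/-- Pointed models that are bisimilar up to depth `k` with respect to `Q` have a common refinement:
a model that is collectively `p`-bisimilar to the first one and bisimilar up to depth `k` to the
second one with respect to `Q` and `p`. -/
lemma exists_amalgam {L : ModalSystem} {Q : Set Atom} {p : Atom} {M N : Model (Fin 2) Atom}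
    {x : M.World} {y : N.World} {k : ℕ} (hM : L.IsModel M) (hN : L.IsModel N)
    (h : BisimUpTo Q M N k x y) :
    ∃ (A : Model (Fin 2) Atom) (a : A.World), L.IsModel A ∧ ColBisimilar p A a M x ∧
      BisimUpTo {q | q ∈ Q ∨ q = p} A N k a y := by
  -- Both labels start at `k`: matching successors to depth `k - 1` is exactly what the hypothesis
  -- gives.
  let r : AmalgamWorld Q M N := ⟨x, y, fun _ => k, fun _ _ => Nat.le_succ k,
    fun _ l hl => h.mono (hl 0), fun i l hl => h.relMatch (by omega) i⟩
  exact ⟨Model.amalgam Q p M N r, r, hM.amalgam hN Q p r,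
    amalgam_colBisimilar hM.isTransitive hM.isEuclidean hN.isTransitive hN.isEuclidean r,
    amalgam_bisimUpTo hM.isTransitive hM.isEuclidean hN.isTransitive hN.isEuclidean r
      (fun _ => le_rfl) h⟩

variable [DecidableEq Atom]

/-- A model of `δ^p` is collectively `p`-bisimilar to a model that satisfies the same formulas as a
given model of `δ`, up to the level of `δ`. -/
lemma exists_colBisimilar_of_sat_litElim {L : ModalSystem} {P : Finset Atom} {p : Atom} {k : ℕ}
    {δ φ : Formula (Fin 2) Atom} (hδ : δ ∈ dCanonical P k) (hφP : φ.atoms ⊆ P) (hφk : φ.depth ≤ k)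
    {M N : Model (Fin 2) Atom} {x : M.World} {y : N.World} (hM : L.IsModel M) (hN : L.IsModel N)
    (hx : M.Sat x (δ.litElim p)) (hy : N.Sat y δ) (hφ : N.Sat y φ) :
    ∃ (A : Model (Fin 2) Atom) (a : A.World), L.IsModel A ∧ A.Sat a φ ∧ ColBisimilar p A a M x := by
  obtain ⟨A, a, hA, hb, ha⟩ := exists_amalgam (p := p) hM hN (BisimUpTo.of_dCanonical hδ hx hy)
  refine ⟨A, a, hA, (ha.sat_iff (fun q hq => ?_) hφk).2 hφ, hb⟩
  by_cases h : q = p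
  · exact Or.inr h
  · exact Or.inl ⟨hφP hq, h⟩

/-- Models of `φ` and of `ψ` are the same up to `p`-bisimilarity, which `p`-free consequences cannot
detect. -/
lemma IsForgetting.isUniformInterpolant {Agent : Type w} {L : ModalSystem} {P : Finset Atom}
    {p : Atom} {φ ψ : Formula Agent Atom} (h : L.IsForgetting φ p ψ) (hφ : φ.atoms ⊆ P)
    (hsat : L.Satisfiable φ) : L.IsUniformInterpolant P φ p ψ where
  satisfiable := by
    obtain ⟨M, s, hM, hs⟩ := hsat
    exact ⟨M, s, hM, h.forth M s M s hM hM hs (ColBisimilar.refl p M s)⟩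
  atoms_subset := h.atoms_subset.trans (Finset.sdiff_subset_sdiff hφ subset_rfl)
  entails_iff χ hχ := by
    constructor
    · intro he M' s' hM' hs'
      obtain ⟨M, s, hM, hs, hb⟩ := h.back M' s' hM' hs'
      exact (hb.sat_iff hχ).1 (he M s hM hs)
    · intro he M s hM hs
      exact he M s hM (h.forth M s M s hM hM hs (ColBisimilar.refl p M s))

lemma not_mem_litElim_atoms {Agent : Type w} (p : Atom) (φ : Formula Agent Atom) :
    p ∉ (φ.litElim p).atoms := fun h => by
  simpa using litElim_atoms_subset p φ h

lemma isForgetting_litElim {L : ModalSystem} {P : Finset Atom} (p : Atom) {k : ℕ}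
    {δ : Formula (Fin 2) Atom} (hδ : δ ∈ dCanonical P k) (hsat : L.Satisfiable δ) :
    L.IsForgetting δ p (δ.litElim p) where
  atoms_subset := litElim_atoms_subset p δ
  forth _ _ _ _ _ _ hs hb :=
    (hb.sat_iff (not_mem_litElim_atoms p δ)).1 (sat_litElim_of_sat hδ hs)
  back M' s' hM' hs' := by
    obtain ⟨N, y, hN, hy⟩ := hsat
    exact exists_colBisimilar_of_sat_litElim hδ (dCanonical_atoms_subset hδ)
      (dCanonical_depth_le hδ) hM' hN hs' hy hy

lemma exists_isForgetting (L : ModalSystem) (p : Atom) (φ : Formula (Fin 2) Atom) :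
    ∃ ψ : Formula (Fin 2) Atom, L.IsForgetting φ p ψ ∧ ψ.depth = φ.depth := by
  classical
  set k := φ.depth with hk
  let D : Finset (Formula (Fin 2) Atom) :=
    -- Consistency with `φ` provides one model of both `δ` and `φ`, to be amalgamated with a given
    -- model of `δ^p`.
    (dCanonical_finite φ.atoms k).toFinset.filter fun δ => L.Satisfiable (and δ φ)
  have hD : ∀ {δ}, δ ∈ D ↔ δ ∈ dCanonical φ.atoms k ∧ L.Satisfiable (and δ φ) := by simp [D]
  -- The disjunction may have depth below `k`, for instance when covers are empty; this valid
  -- conjunct makes the depth exact.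
  let pad : Formula (Fin 2) Atom := depthPadding ⟨{0}, Finset.singleton_nonempty 0⟩ k
  have hsat : ∀ (M : Model (Fin 2) Atom) (s : M.World),
      M.Sat s (and (disj (D.toList.map (litElim p))) pad) ↔ ∃ δ ∈ D, M.Sat s (δ.litElim p) := by
    intro M s
    simp [Sat, sat_disj, pad, sat_depthPadding]
  have hatoms : (and (disj (D.toList.map (litElim p))) pad).atoms ⊆ φ.atoms \ {p} := by
    refine Finset.union_subset (disj_atoms_subset (List.forall_mem_map.2 fun δ hδ => ?_)) ?_
    · exact (litElim_atoms_subset p δ).trans (Finset.sdiff_subset_sdiff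
        (dCanonical_atoms_subset (hD.1 (Finset.mem_toList.1 hδ)).1) subset_rfl)
    · simp [pad, depthPadding_atoms]
  refine ⟨and (disj (D.toList.map (litElim p))) pad, ⟨hatoms, ?_, ?_⟩, ?_⟩
  · intro M s M' s' hM _ hs hb
    rw [← hb.sat_iff fun h => by simpa using hatoms h, hsat]
    obtain ⟨δ, hδ, hδs⟩ := exists_dCanonical_sat φ.atoms k M s
    exact ⟨δ, hD.2 ⟨hδ, M, s, hM, hδs, hs⟩, sat_litElim_of_sat hδ hδs⟩
  · intro M' s' hM' hs'
    obtain ⟨δ, hδ, hδs⟩ := (hsat M' s').1 hs'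
    obtain ⟨hδc, N, y, hN, hy, hφ⟩ := hD.1 hδ
    exact exists_colBisimilar_of_sat_litElim hδc subset_rfl hk.ge hM' hN hδs hy hφ
  · change max _ pad.depth = k
    rw [depthPadding_depth]
    refine max_eq_right (disj_depth_le (List.forall_mem_map.2 fun δ hδ => ?_))
    rw [litElim_depth]
    exact dCanonical_depth_le (hD.1 (Finset.mem_toList.1 hδ)).1

end ModalSystem

end DistKnow

theorem mainTheorem7 {Atom : Type*} [DecidableEq Atom] (L : DistKnow.ModalSystem)
    (P : Finset Atom) (p : Atom) :
    (∀ (k : ℕ) (δ : DistKnow.Formula (Fin 2) Atom),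
      δ ∈ DistKnow.Formula.dCanonical P k → L.Satisfiable δ →
        L.IsForgetting δ p (δ.litElim p) ∧
        L.IsUniformInterpolant P δ p (δ.litElim p) ∧
        (δ.litElim p).depth = δ.depth) ∧
    (∀ φ : DistKnow.Formula (Fin 2) Atom, φ.atoms ⊆ P → L.Satisfiable φ →
      ∃ ψ : DistKnow.Formula (Fin 2) Atom,
        L.IsForgetting φ p ψ ∧ L.IsUniformInterpolant P φ p ψ ∧ ψ.depth = φ.depth) := by
  refine ⟨fun k δ hδ hsat => ?_, fun φ hφ hsat => ?_⟩
  · have h := DistKnow.ModalSystem.isForgetting_litElim p hδ hsat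
    exact ⟨h, h.isUniformInterpolant (DistKnow.Formula.dCanonical_atoms_subset hδ) hsat,
      DistKnow.Formula.litElim_depth p δ⟩
  · obtain ⟨ψ, h, hd⟩ := DistKnow.ModalSystem.exists_isForgetting L p φ
    exact ⟨ψ, h, h.isUniformInterpolant hφ hsat, hd⟩
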